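/- **Setting.** Let $(\mathfrak A,\mathfrak A_0)$ be a quasi *-algebra with unit $e\in\mathfrak A_0$: $\mathfrak A$ is a complex vector space with involution, $\mathfrak A_0\subseteq\mathfrak A$ is a unital *-algebra, the products $ax$, $xa$ ($a\in\mathfrak A$, $x\in\mathfrak A_0$) are defined, bilinear and extend the multiplication of $\mathfrak A_0$, and $x_1(x_2a)=(x_1x_2)a$, $x_1(ax_2)=(x_1a)x_2$, $(ax)^*=x^*a^*$, $(xa)^*=a^*x^*$, $ea=ae=a$. For a dense subspace $\mathcal D$ of a Hilbert space $\mathcal H$ let $\mathcal L^\dagger(\mathcal D,\mathcal H)$ be the set of linear operators $X:\mathcal D\to\mathcal H$ with $D(X^*)\supseteq\mathcal D$, and $X^\dagger=X^*|_{\mathcal D}$. A *-representation of $(\mathfrak A,\mathfrak A_0)$ is a linear map $\pi:\mathfrak A\to\mathcal L^\dagger(\mathcal D_\pi,\mathcal H_\pi)$ such that $\pi(a^*)=\pi(a)^\dagger$, $\pi(x)\mathcal D_\pi\subseteq\mathcal D_\pi$, and the weak product $\pi(a)\Box\pi(x)=\pi(a)^{\dagger *}\pi(x)$ is defined (that is,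 $\pi(x)\mathcal D_\pi\subseteq D(\pi(a)^{\dagger *})$ and $\pi(a)^*\mathcal D_\pi\subseteq D(\pi(x)^*)$) and equals $\pi(ax)$, for $a\in\mathfrak A$, $x\in\mathfrak A_0$. Suppose that for every $a\neq0$ there is a *-representation with $\pi(a)\ne0$, let $\tau_{rep}$ be the weakest locally convex topology on $\mathfrak A$ for which all *-representations are continuous into the strong* topologies (seminorms $a\mapsto\|\pi(a)\xi\|+\|\pi(a^*)\xi\|$), and suppose that $\mathfrak A_0$ is $\tau_{rep}$-dense in $\mathfrak A$. Let $\mathcal F$ be an upward directed set with a relation $\perp$ such that: every $\alpha$ has some $\beta$ with $\alpha\perp\beta$; $\alpha\le\beta$ and $\beta\perp\gamma$ imply $\alpha\perp\gamma$; $\alpha\perp\beta$ and $\alpha\perp\gamma$ imply $\alpha\perp\delta$ for some $\delta\ge\beta,\gamma$. Let $\mathfrak A_0=\bigcup_{\alpha\in\mathcal F}\mathfrak A_\alpha$, where each $\mathfrak A_\alpha$ is a *-subalgebra containing $e$ that is a C*-algebra for a norm $\|\cdot\|_\alpha$, with $\mathfrak A_\beta\subseteq\mathfrak A_\alpha$ if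 $\beta\le\alpha$, with $xy=yx$ for $x\in\mathfrak A_\alpha$, $y\in\mathfrak A_\beta$ if $\alpha\perp\beta$, and with $\|x\|_\alpha=\|x\|_\beta$ for $x\in\mathfrak A_\alpha\cap\mathfrak A_\beta$; write $\|x\|$ for this common value. Let $G$ be a group acting on $\mathcal F$ by invertible maps, and $g\mapsto\tau_g$ a homomorphism from $G$ to the isometric *-automorphisms of $\mathfrak A_0$ with $\tau_g(\mathfrak A_\alpha)=\mathfrak A_{g(\alpha)}$. Let $\mathbf g=(g_j)_{j\in\mathbb N}$ be a sequence in $G$ such that for every $\alpha\in\mathcal F$ there is $j_\alpha$ with $g_j(\alpha)\perp\alpha$ for all $j\ge j_\alpha$. For $x\in\mathfrak A_0$ and $N\ge1$ put $x_N=\frac1N\sum_{j=1}^N\tau_{g_j}(x)$. A state is a linear functional $\omega$ on $\mathfrak A$ with $\omega(e)=1$ which is representable: for $a,b\in\mathfrak A_0$ and $x\in\mathfrak A$, $\omega(a^*a)\ge0$ and $\omega(b^*x^*a)=\overline{\omega(a^*xb)}$, and for every $x\in\mathfrak A$ there is $\gamma_x>0$ with $|\omega(x^*a)|\le\gamma_x\,\omega(a^*a)^{1/2}$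 for all $a\in\mathfrak A_0$. Let $\pi_\omega$ be its GNS representation, on the completion $\mathcal H_\omega$ of $\mathfrak A_0$ for $(a,b)\mapsto\omega(b^*a)$ (modulo null vectors), with domain $\lambda_\omega(\mathfrak A_0)$ and $\pi_\omega(x)\lambda_\omega(a)=\lambda_\omega(xa)$. Its weak commutant $\pi_\omega(\mathfrak A)'_{\mathrm w}$ is the set of bounded operators $X$ on $\mathcal H_\omega$ with $\langle\pi_\omega(a)\xi, X^*\eta\rangle=\langle X\xi,\pi_\omega(a^*)\eta\rangle$ for all $a\in\mathfrak A$ and $\xi,\eta\in\lambda_\omega(\mathfrak A_0)$. The state $\omega$ is primary if $\pi_\omega(\mathfrak A)'_{\mathrm w}\cap(\pi_\omega(\mathfrak A)'_{\mathrm w})'$ consists only of the multiples of the unit operator. For $x\in\mathfrak A_0$ let $D(x_\infty)$ be the set of states $\omega$ for which $\omega(x_\infty):=\lim_{N\to\infty}\omega(x_N)$ exists. **Proposition.** Let $\omega$ be a primary state. Then $\omega$ has the cluster property relative to $\mathbf g$: $$|\omega(a\,\tau_{g_j}(x))-\omega(a)\,\omega(\tau_{g_j}(x))|\to0\quad(j\to\infty)\qquad\text{for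 all }a\in\mathfrak A,\ x\in\mathfrak A_0.$$ Moreover, for every $x\in\mathfrak A_0$ with $\omega\in D(x_\infty)$, $$|\omega(a\,x_N)-\omega(a)\,\omega(x_\infty)|\to0\quad(N\to\infty)\qquad\text{for all }a\in\mathfrak A.$$ -/

import Mathlib

open Filter Topology
open scoped ComplexOrder

universe u v

noncomputable section

/-! ### Quasi *-algebras -/

/-- `(A, A₀)` is a quasi *-algebra with unit: `A₀` is a unital *-algebra, contained (through the
injective linear map `incl`) in the complex vector space `A` with involution; the products
`x a = lmul x a` and `a x = rmul a x` of `x ∈ A₀` and `a ∈ A` are defined, bilinear and extend the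
multiplication of `A₀`. -/
class QuasiStarAlgebra (A₀ A : Type u) [Ring A₀] [StarRing A₀] [Algebra ℂ A₀] [StarModule ℂ A₀]
    [AddCommGroup A] [Module ℂ A] [StarAddMonoid A] [StarModule ℂ A] where
  incl : A₀ →ₗ[ℂ] A
  incl_injective : Function.Injective incl
  lmul : A₀ →ₗ[ℂ] A →ₗ[ℂ] A
  rmul : A →ₗ[ℂ] A₀ →ₗ[ℂ] A
  lmul_incl : ∀ x y : A₀, lmul x (incl y) = incl (x * y)
  rmul_incl : ∀ x y : A₀, rmul (incl x) y = incl (x * y)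
  lmul_lmul : ∀ (x₁ x₂ : A₀) (a : A), lmul x₁ (lmul x₂ a) = lmul (x₁ * x₂) a
  lmul_rmul : ∀ (x₁ x₂ : A₀) (a : A), lmul x₁ (rmul a x₂) = rmul (lmul x₁ a) x₂
  star_incl : ∀ x : A₀, star (incl x) = incl (star x)
  star_rmul : ∀ (a : A) (x : A₀), star (rmul a x) = lmul (star x) (star a)
  star_lmul : ∀ (x : A₀) (a : A), star (lmul x a) = rmul (star a) (star x)
  one_lmul : ∀ a : A, lmul 1 a = a
  rmul_one : ∀ a : A, rmul a 1 = a

open QuasiStarAlgebra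

/-! ### The partial *-algebra of operators on a dense domain -/

section Operators

variable {H : Type u} [NormedAddCommGroup H] [InnerProductSpace ℂ H] [CompleteSpace H]

/-- An everywhere defined linear map on `D`, regarded as an operator in `H` with domain `D`. -/
def asOperator {D : Submodule ℂ H} (X : D →ₗ[ℂ] H) : H →ₗ.[ℂ] H := ⟨D, X⟩

/-- `𝓛†(D, H)`: the linear operators `X` with domain `D` such that `D(X*) ⊇ D`. -/
def LDagger (D : Submodule ℂ H) : Submodule ℂ (D →ₗ[ℂ] H) where
  carrier := {X | D ≤ (asOperator X).adjoint.domain}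
  zero_mem' := fun y _ =>
    LinearPMap.mem_adjoint_domain_of_exists y ⟨0, fun x => by
      rw [inner_zero_left]; exact (inner_zero_right y).symm⟩
  add_mem' := by
    intro X Y hX hY y hy
    have h1 := (LinearPMap.mem_adjoint_domain_iff _ y).1 (hX hy)
    have h2 := (LinearPMap.mem_adjoint_domain_iff _ y).1 (hY hy)
    refine (LinearPMap.mem_adjoint_domain_iff _ y).2 ?_
    refine (h1.add h2).congr fun x => ?_
    exact (inner_add_right (𝕜 := ℂ) y (X x) (Y x)).symm
  smul_mem' := by
    intro c X hX y hy
    have h1 := (LinearPMap.mem_adjoint_domain_iff _ y).1 (hX hy)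
    refine (LinearPMap.mem_adjoint_domain_iff _ y).2 ?_
    refine (h1.const_smul c).congr fun x => ?_
    exact (inner_smul_right (𝕜 := ℂ) y (X x) c).symm

/-- The involution of `𝓛†(D, H)`: `X†` is the restriction of `X*` to `D`. -/
def dag {D : Submodule ℂ H} (X : LDagger D) : D →ₗ[ℂ] H :=
  (asOperator X.1).adjoint.toFun ∘ₗ Submodule.inclusion X.2

/-- `Z = X □ Y` for the weak partial multiplication `X □ Y = (X†)* Y`: the product is defined, that
is `Y D ⊆ D((X†)*)` and `X* D ⊆ D(Y*)`, and it is equal to `Z`. -/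
def IsWeakProduct {D : Submodule ℂ H} (X Y Z : LDagger D) : Prop :=
  (∃ h : ∀ ξ : D, Y.1 ξ ∈ (asOperator (dag X)).adjoint.domain,
      ∀ ξ : D, Z.1 ξ = (asOperator (dag X)).adjoint ⟨Y.1 ξ, h ξ⟩) ∧
    ∀ ξ : D, dag X ξ ∈ (asOperator Y.1).adjoint.domain

/-- The weak bounded commutant of a family of operators in `𝓛†(D, H)`. A bounded element of
`𝓛†(D, H)` is identified with its unique continuous extension to `H`; for such an `X`, the operator
`X†` is the restriction of the Hilbert space adjoint. -/
def weakCommutant {D : Submodule ℂ H} (O : Set (LDagger D)) : Set (H →L[ℂ] H) :=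
  {X | ∀ T ∈ O, ∀ ξ η : D,
    inner ℂ (ContinuousLinearMap.adjoint X (η : H)) (T.1 ξ) = inner ℂ (dag T η) (X (ξ : H))}

end Operators

/-! ### Representations and the topology they define -/

section Representations

variable (A₀ A : Type u) [Ring A₀] [StarRing A₀] [Algebra ℂ A₀] [StarModule ℂ A₀]
  [AddCommGroup A] [Module ℂ A] [StarAddMonoid A] [StarModule ℂ A] [QuasiStarAlgebra A₀ A]

/-- A *-representation of the quasi *-algebra `(A, A₀)` on the dense domain `D` of the Hilbert
space `H`. -/
structure StarRep {H : Type u} [NormedAddCommGroup H] [InnerProductSpace ℂ H] [CompleteSpace H]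
    (D : Submodule ℂ H) where
  dense : Dense (D : Set H)
  toLin : A →ₗ[ℂ] LDagger D
  map_star : ∀ a : A, (toLin (star a)).1 = dag (toLin a)
  map_rmul : ∀ (a : A) (x : A₀), IsWeakProduct (toLin a) (toLin (incl x)) (toLin (rmul a x))
  invariant : ∀ (x : A₀) (ξ : D), (toLin (incl x)).1 ξ ∈ D

/-- The family of all *-representations of `(A, A₀)` is faithful. -/
def RepFaithful : Prop :=
  ∀ a : A, a ≠ 0 → ∃ (H : Type u) (_ : NormedAddCommGroup H) (_ : InnerProductSpace ℂ H)
    (_ : CompleteSpace H) (D : Submodule ℂ H) (π : StarRep A₀ A D), π.toLin a ≠ 0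

/-- The topology `τ_rep`: the weakest one for which every *-representation is continuous into
`𝓛†(D, H)` with the strong* topology, which is given by the maps `X ↦ X ξ` and `X ↦ X† ξ`. It is enough to use Hilbert
spaces in the universe of `A`: every vector of the domain of a *-representation belongs to the domain
of a restriction of it to a Hilbert space of cardinality at most that of `A`, up to countable
powers. -/
@[reducible] def tauRep : TopologicalSpace A :=
  ⨅ (H : Type u) (_ : NormedAddCommGroup H) (_ : InnerProductSpace ℂ H) (_ : CompleteSpace H)
    (D : Submodule ℂ H) (π : StarRep A₀ A D) (ξ : D),
    TopologicalSpace.induced (fun a : A => ((π.toLin a).1 ξ, dag (π.toLin a) ξ))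
      (inferInstance : TopologicalSpace (H × H))

end Representations

/-! ### Representable functionals and the GNS construction -/

section Functionals

variable {A₀ A : Type u} [Ring A₀] [StarRing A₀] [Algebra ℂ A₀] [StarModule ℂ A₀]
  [AddCommGroup A] [Module ℂ A] [StarAddMonoid A] [StarModule ℂ A] [QuasiStarAlgebra A₀ A]

variable (A₀) in
/-- Representable linear functionals. -/
structure IsRepresentable (ω : A →ₗ[ℂ] ℂ) : Prop where
  nonneg : ∀ a : A₀, 0 ≤ ω (incl (star a * a))
  hermitian : ∀ (a b : A₀) (x : A),
    ω (lmul (star b) (rmul (star x) a)) = star (ω (lmul (star a) (rmul x b)))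
  bounded : ∀ x : A, ∃ γ : ℝ, 0 < γ ∧
    ∀ a : A₀, ‖ω (rmul (star x) a)‖ ≤ γ * √(ω (incl (star a * a))).re

variable (A₀) in
/-- The states: representable functionals with `ω(e) = 1`. -/
def IsState (ω : A →ₗ[ℂ] ℂ) : Prop :=
  IsRepresentable A₀ ω ∧ ω (incl (1 : A₀)) = 1

lemma rmul_rmul (a : A) (x y : A₀) : rmul (rmul a x) y = rmul a (x * y) := by
  have h : star (rmul (rmul a x) y) = star (rmul a (x * y)) := by
    rw [star_rmul, star_rmul, star_rmul, lmul_lmul, star_mul]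
  exact star_injective h

lemma IsRepresentable.star_lmul_incl {ω : A →ₗ[ℂ] ℂ} (hω : IsRepresentable A₀ ω)
    (a : A₀) (x : A) : ω (lmul (star a) x) = star (ω (rmul (star x) a)) := by
  have h := hω.hermitian a 1 x
  rw [star_one, one_lmul, rmul_one] at h
  rw [h, star_star]

/-- The vector space `A₀`, to be equipped with the semi-inner product `⟪a, b⟫ = ω(a* b)`. -/
@[nolint unusedArguments]
def PreGNS {ω : A →ₗ[ℂ] ℂ} (_ : IsRepresentable A₀ ω) : Type u := A₀

namespace PreGNS

variable {ω : A →ₗ[ℂ] ℂ} (hω : IsRepresentable A₀ ω)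

instance : AddCommGroup (PreGNS hω) := inferInstanceAs (AddCommGroup A₀)
instance : Module ℂ (PreGNS hω) := inferInstanceAs (Module ℂ A₀)

/-- The identity map from `A₀` to `PreGNS hω`. -/
def mk : A₀ ≃ₗ[ℂ] PreGNS hω := LinearEquiv.refl ℂ _

/-- The semi-inner product `⟪a, b⟫ = ω(a* b)`, linear in the second variable. -/
abbrev core : PreInnerProductSpace.Core ℂ (PreGNS hω) where
  inner a b := ω (incl (star ((mk hω).symm a) * (mk hω).symm b))
  conj_inner_symm a b := by
    have h := hω.star_lmul_incl ((mk hω).symm a) (incl ((mk hω).symm b))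
    rw [lmul_incl, star_incl, rmul_incl] at h
    exact h.symm
  re_inner_nonneg a := (RCLike.nonneg_iff.mp (hω.nonneg ((mk hω).symm a))).1
  add_left a b c := by simp [add_mul]
  smul_left a b r := by simp

instance : SeminormedAddCommGroup (PreGNS hω) :=
  InnerProductSpace.Core.toSeminormedAddCommGroup (c := core hω)
instance : InnerProductSpace ℂ (PreGNS hω) := InnerProductSpace.ofCore (core hω)

lemma inner_mk (a b : A₀) : inner ℂ (mk hω a) (mk hω b) = ω (incl (star a * b)) := rfl

lemma norm_mk (a : A₀) : ‖mk hω a‖ = √(ω (incl (star a * a))).re := rfl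

end PreGNS

/-- The GNS Hilbert space of `ω`: the Hausdorff completion of `A₀` for `⟪a, b⟫ = ω(a* b)`. -/
abbrev GNSSpace {ω : A →ₗ[ℂ] ℂ} (hω : IsRepresentable A₀ ω) : Type u :=
  UniformSpace.Completion (PreGNS hω)

namespace GNS

variable {ω : A →ₗ[ℂ] ℂ} (hω : IsRepresentable A₀ ω)

/-- The canonical map from `A₀` to the GNS space. -/
def vec₀ : A₀ →ₗ[ℂ] GNSSpace hω :=
  (UniformSpace.Completion.toComplL : PreGNS hω →L[ℂ] GNSSpace hω).toLinearMap ∘ₗ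
    (PreGNS.mk hω).toLinearMap

lemma denseRange_vec₀ : DenseRange (vec₀ hω) :=
  (UniformSpace.Completion.denseRange_coe (α := PreGNS hω))

lemma inner_vec₀ (a b : A₀) : inner ℂ (vec₀ hω a) (vec₀ hω b) = ω (incl (star a * b)) :=
  UniformSpace.Completion.inner_coe (𝕜 := ℂ) (PreGNS.mk hω a) (PreGNS.mk hω b)

lemma norm_vec₀ (a : A₀) : ‖vec₀ hω a‖ = √(ω (incl (star a * a))).re :=
  UniformSpace.Completion.norm_coe (PreGNS.mk hω a)

lemma ext_inner {v w : GNSSpace hω}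
    (h : ∀ b : A₀, inner ℂ v (vec₀ hω b) = inner ℂ w (vec₀ hω b)) : v = w := by
  refine Dense.eq_of_inner_left ℂ (denseRange_vec₀ hω) ?_
  rintro _ ⟨b, rfl⟩
  exact h b

lemma exists_vec (x : A) :
    ∃ v : GNSSpace hω, ∀ b : A₀, inner ℂ v (vec₀ hω b) = ω (rmul (star x) b) := by
  obtain ⟨γ, -, hγ⟩ := hω.bounded x
  let f : PreGNS hω →L[ℂ] ℂ :=
    LinearMap.mkContinuous (ω ∘ₗ rmul (star x) ∘ₗ (PreGNS.mk hω).symm.toLinearMap) γ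
      (fun a => hγ ((PreGNS.mk hω).symm a))
  let F : GNSSpace hω →L[ℂ] ℂ := f.extend UniformSpace.Completion.toComplL
  refine ⟨(InnerProductSpace.toDual ℂ _).symm F, fun b => ?_⟩
  rw [InnerProductSpace.toDual_symm_apply]
  exact ContinuousLinearMap.extend_eq f UniformSpace.Completion.denseRange_coe
    (UniformSpace.Completion.isUniformInducing_coe _) (PreGNS.mk hω b)

/-- The linear map `λ_ω : A → H_ω`, characterized by `⟪λ_ω(x), λ_ω(b)⟫ = ω(x* b)` for `b ∈ A₀`. -/
def vec : A →ₗ[ℂ] GNSSpace hω where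
  toFun x := (exists_vec hω x).choose
  map_add' x y := ext_inner hω fun b => by
    rw [inner_add_left, (exists_vec hω _).choose_spec, (exists_vec hω _).choose_spec,
      (exists_vec hω _).choose_spec, star_add, map_add, LinearMap.add_apply, map_add]
  map_smul' c x := ext_inner hω fun b => by
    rw [RingHom.id_apply, inner_smul_left, (exists_vec hω _).choose_spec,
      (exists_vec hω _).choose_spec, star_smul, map_smul, LinearMap.smul_apply, map_smul]
    rfl

lemma inner_vec (x : A) (b : A₀) : inner ℂ (vec hω x) (vec₀ hω b) = ω (rmul (star x) b) :=
  (exists_vec hω x).choose_spec b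

lemma vec_incl (a : A₀) : vec hω (incl a) = vec₀ hω a := ext_inner hω fun b => by
  rw [inner_vec, inner_vec₀, star_incl, rmul_incl]

/-- `⟪λ(x* b), λ(c)⟫ = ⟪λ(b), λ(x c)⟫` for `x ∈ A` and `b, c ∈ A₀`. -/
lemma inner_rmul (x : A) (b c : A₀) :
    inner ℂ (vec hω (rmul (star x) b)) (vec₀ hω c) = inner ℂ (vec₀ hω b) (vec hω (rmul x c)) := by
  rw [inner_vec, ← inner_conj_symm, inner_vec, star_rmul, star_rmul, star_star, ← lmul_rmul,
    ← lmul_rmul]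
  have h := hω.hermitian c b (star x)
  rw [star_star] at h
  exact h

/-- `⟪λ(x* y), λ(c)⟫ = ⟪λ(y), λ(x c)⟫` for `y ∈ A` and `x, c ∈ A₀`. -/
lemma inner_lmul (y : A) (x c : A₀) :
    inner ℂ (vec hω (lmul (star x) y)) (vec₀ hω c) = inner ℂ (vec hω y) (vec₀ hω (x * c)) := by
  rw [inner_vec, inner_vec, star_lmul, star_star, rmul_rmul]

/-- The domain `D = λ_ω(A₀)`. -/
abbrev dom : Submodule ℂ (GNSSpace hω) := LinearMap.range (vec₀ hω)

lemma dense_dom : Dense (dom hω : Set (GNSSpace hω)) := denseRange_vec₀ hω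

/-- The element `λ_ω(b)` of the domain, for `b ∈ A₀`. -/
def domVec : A₀ →ₗ[ℂ] dom hω := (vec₀ hω).rangeRestrict

lemma domVec_surjective : Function.Surjective (domVec hω) := (vec₀ hω).surjective_rangeRestrict

lemma ker_le (x : A) :
    LinearMap.ker (vec₀ hω) ≤ LinearMap.ker (vec hω ∘ₗ rmul (A₀ := A₀) x) := by
  intro c hc
  rw [LinearMap.mem_ker] at hc ⊢
  refine ext_inner hω fun b => ?_
  rw [LinearMap.comp_apply, ← inner_conj_symm, ← inner_rmul, hc]
  simp

/-- The operator `π_ω(x)`, given by `π_ω(x) λ_ω(b) = λ_ω(x b)` for `b ∈ A₀`. -/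
def op (x : A) : dom hω →ₗ[ℂ] GNSSpace hω :=
  (LinearMap.ker (vec₀ hω)).liftQ (vec hω ∘ₗ rmul x) (ker_le hω x) ∘ₗ
    (vec₀ hω).quotKerEquivRange.symm.toLinearMap

lemma op_domVec (x : A) (b : A₀) : op hω x (domVec hω b) = vec hω (rmul x b) := by
  have h : (vec₀ hω).quotKerEquivRange.symm (domVec hω b) = Submodule.Quotient.mk b := by
    rw [LinearEquiv.symm_apply_eq]
    rfl
  simp only [op, LinearMap.comp_apply, LinearEquiv.coe_coe]
  rw [h]
  rfl

lemma inner_op (x : A) (ξ η : dom hω) :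
    inner ℂ (op hω (star x) ξ) (η : GNSSpace hω) = inner ℂ (ξ : GNSSpace hω) (op hω x η) := by
  obtain ⟨b, rfl⟩ := domVec_surjective hω ξ
  obtain ⟨c, rfl⟩ := domVec_surjective hω η
  rw [op_domVec, op_domVec]
  exact inner_rmul hω x b c

lemma op_mem (x : A) : op hω x ∈ LDagger (dom hω) := fun y hy =>
  LinearPMap.mem_adjoint_domain_of_exists y
    ⟨op hω (star x) ⟨y, hy⟩, fun η => inner_op hω x ⟨y, hy⟩ η⟩

/-- `π_ω` as a linear map into `𝓛†(D, H_ω)`. -/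
def opLin : A →ₗ[ℂ] LDagger (dom hω) where
  toFun x := ⟨op hω x, op_mem hω x⟩
  map_add' x y := by
    refine Subtype.ext (LinearMap.ext fun ξ => ?_)
    obtain ⟨b, rfl⟩ := domVec_surjective hω ξ
    simp [op_domVec]
  map_smul' c x := by
    refine Subtype.ext (LinearMap.ext fun ξ => ?_)
    obtain ⟨b, rfl⟩ := domVec_surjective hω ξ
    simp [op_domVec]

lemma dag_opLin (x : A) : dag (opLin hω x) = op hω (star x) := by
  refine LinearMap.ext fun ξ => ?_
  exact LinearPMap.adjoint_apply_eq (dense_dom hω) _ fun η => inner_op hω x ξ η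

/-- The GNS representation `π_ω` of a representable functional `ω`. -/
def rep : StarRep A₀ A (dom hω) where
  dense := dense_dom hω
  toLin := opLin hω
  map_star a := (dag_opLin hω a).symm
  invariant x ξ := by
    obtain ⟨b, rfl⟩ := domVec_surjective hω ξ
    change op hω (incl x) (domVec hω b) ∈ dom hω
    rw [op_domVec, rmul_incl, vec_incl]
    exact ⟨_, rfl⟩
  map_rmul a x := by
    have key : ∀ ξ η : dom hω, inner ℂ (op hω (rmul a x) ξ) (η : GNSSpace hω) =
        inner ℂ (op hω (incl x) ξ) (dag (opLin hω a) η) := by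
      intro ξ η
      obtain ⟨b, rfl⟩ := domVec_surjective hω ξ
      obtain ⟨c, rfl⟩ := domVec_surjective hω η
      rw [dag_opLin, op_domVec, op_domVec, op_domVec, rmul_incl, vec_incl, rmul_rmul]
      have h := inner_rmul hω (star a) (x * b) c
      rw [star_star] at h
      exact h
    refine ⟨⟨fun ξ => LinearPMap.mem_adjoint_domain_of_exists _
      ⟨op hω (rmul a x) ξ, key ξ⟩, fun ξ => ?_⟩, fun ξ => ?_⟩
    · exact (LinearPMap.adjoint_apply_eq (dense_dom hω) _ (key ξ)).symm
    · obtain ⟨b, rfl⟩ := domVec_surjective hω ξ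
      refine LinearPMap.mem_adjoint_domain_of_exists _
        ⟨vec hω (lmul (star x) (rmul (star a) b)), fun η => ?_⟩
      obtain ⟨c, rfl⟩ := domVec_surjective hω η
      change inner ℂ _ (vec₀ hω c) =
        inner ℂ (dag (opLin hω a) (domVec hω b)) (op hω (incl x) (domVec hω c))
      rw [dag_opLin, op_domVec, op_domVec, rmul_incl, vec_incl, inner_lmul]

/-- `ω(x) = ⟪ξ_ω, π_ω(x) ξ_ω⟫` with the ultra-cyclic vector `ξ_ω = λ_ω(e)`. -/
lemma inner_cyclic (x : A) :
    inner ℂ (vec₀ hω 1) (((rep hω).toLin x).1 (domVec hω 1)) = ω x := by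
  change inner ℂ (vec₀ hω 1) (op hω x (domVec hω 1)) = ω x
  have h := hω.star_lmul_incl 1 x
  rw [star_one, one_lmul] at h
  rw [op_domVec, rmul_one, ← inner_conj_symm, inner_vec, h]
  rfl

end GNS

/-- `ω` is primary: the center of the von Neumann algebra `π_ω(A)'_w` consists only of the
multiples of the unit operator. -/
def IsPrimary {ω : A →ₗ[ℂ] ℂ} (hω : IsRepresentable A₀ ω) : Prop :=
  ∀ T ∈ weakCommutant (Set.range (GNS.rep hω).toLin) ∩
      Set.centralizer (weakCommutant (Set.range (GNS.rep hω).toLin)),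
    ∃ c : ℂ, T = c • (1 : GNSSpace hω →L[ℂ] GNSSpace hω)

end Functionals

/-! ### Local structure -/

section Local

/-- The axioms of an orthogonality relation on an upward directed index set. -/
structure IsOrthogonality {F : Type v} [Preorder F] (perp : F → F → Prop) : Prop where
  exists_perp : ∀ α, ∃ β, perp α β
  of_le : ∀ α β γ, α ≤ β → perp β γ → perp α γ
  exists_upper : ∀ α β γ, perp α β → perp α γ → ∃ δ, perp α δ ∧ β ≤ δ ∧ γ ≤ δ

/-- A net of C*-algebras that defines a local structure on `A₀`. The subspace `A_α` of `A₀` is the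
range of the injective unital *-homomorphism `emb α` defined on the C*-algebra `C α`. -/
structure LocalNet (A₀ : Type u) [Ring A₀] [StarRing A₀] [Algebra ℂ A₀] [StarModule ℂ A₀]
    {F : Type v} [Preorder F] (perp : F → F → Prop) where
  C : F → Type u
  [cstar : ∀ α, CStarAlgebra (C α)]
  emb : ∀ α, C α →⋆ₐ[ℂ] A₀
  emb_injective : ∀ α, Function.Injective (emb α)
  exhaust : ∀ x : A₀, ∃ α, x ∈ Set.range (emb α)
  mono : ∀ α β, β ≤ α → Set.range (emb β) ⊆ Set.range (emb α)
  commute : ∀ α β, perp α β → ∀ x ∈ Set.range (emb α), ∀ y ∈ Set.range (emb β), x * y = y * x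
  norm_eq : ∀ (α β) (x : C α) (y : C β), emb α x = emb β y → ‖x‖ = ‖y‖

attribute [instance] LocalNet.cstar

/-- A covariant action on `A₀` of a group `G` of transformations of the index set, by isometric
*-automorphisms `τ g`. -/
structure CovariantAction {A₀ : Type u} [Ring A₀] [StarRing A₀] [Algebra ℂ A₀] [StarModule ℂ A₀]
    {F : Type v} [Preorder F] {perp : F → F → Prop} (L : LocalNet A₀ perp)
    (G : Type*) [Group G] [MulAction G F] where
  τ : G →* (A₀ ≃⋆ₐ[ℂ] A₀)
  covariant : ∀ (g : G) (α : F), τ g '' Set.range (L.emb α) = Set.range (L.emb (g • α))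
  isometric : ∀ (g : G) (α β : F) (x : L.C α) (y : L.C β),
    τ g (L.emb α x) = L.emb β y → ‖y‖ = ‖x‖

end Local

/-! ### Means, the value at infinity and the cluster property -/

section Asymptotics

variable {A₀ A : Type u} [Ring A₀] [StarRing A₀] [Algebra ℂ A₀] [StarModule ℂ A₀]
  [AddCommGroup A] [Module ℂ A] [StarAddMonoid A] [StarModule ℂ A] [QuasiStarAlgebra A₀ A]

/-- The mean `x_N = N⁻¹ ∑_{j=1}^N σ_j(x)` along a sequence of *-automorphisms. -/
def meanTo (σ : ℕ → A₀ ≃⋆ₐ[ℂ] A₀) (x : A₀) (N : ℕ) : A₀ :=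
  (N : ℂ)⁻¹ • ∑ j ∈ Finset.Icc 1 N, σ j x

/-- The set `D(x_∞)` of the states for which `lim ω(x_N)` exists. -/
def domInfty (A : Type u) [AddCommGroup A] [Module ℂ A] [StarAddMonoid A] [StarModule ℂ A]
    [QuasiStarAlgebra A₀ A] (σ : ℕ → A₀ ≃⋆ₐ[ℂ] A₀) (x : A₀) : Set (A →ₗ[ℂ] ℂ) :=
  {ω | IsState A₀ ω ∧ ∃ l : ℂ, Tendsto (fun N => ω (incl (meanTo σ x N))) atTop (𝓝 l)}

/-- `ω(x_∞) = lim ω(x_N)`, for `ω ∈ D(x_∞)`. -/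
def valueInfty (σ : ℕ → A₀ ≃⋆ₐ[ℂ] A₀) (x : A₀) (ω : A →ₗ[ℂ] ℂ) : ℂ :=
  limUnder atTop (fun N => ω (incl (meanTo σ x N)))

/-- The cluster property of `ω` relative to a sequence of *-automorphisms. -/
def HasClusterProperty (σ : ℕ → A₀ ≃⋆ₐ[ℂ] A₀) (ω : A →ₗ[ℂ] ℂ) : Prop :=
  ∀ (a : A) (x : A₀),
    Tendsto (fun j => ‖ω (rmul a (σ j x)) - ω a * ω (incl (σ j x))‖) atTop (𝓝 0)

end Asymptotics

end

/-!
Every `x ∈ A₀` lies in one of the C*-algebras of the net, so `‖x‖² - x* x` has the form `d* d` and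
left multiplication by `x` extends to a bounded operator `π(x)` on the GNS space, of norm at most
`‖x‖` (`GNS.norm_vec₀_mul_le`, `GNS.exists_bounded_extension`). As the automorphisms are
isometric, the operators `π(τ_{g_j}(x))` are uniformly bounded, and along each ultrafilter finer than
`atTop` they have a limit `T` in the weak operator topology (`exists_weak_operator_limit`).

This limit lies in the center of the von Neumann algebra `π_ω(A)'_w`. It commutes with
`π_ω(A)'_w`, since every `π(τ_{g_j}(x))` does (`GNS.commute_of_mem_weakCommutant`). It also belongs
to `π_ω(A)'_w`: by asymptotic abelianness `τ_{g_j}(x)` commutes eventually with any given element of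
`A₀`, and the density of `A₀` in `A` for `τ_rep` carries the resulting identity from `A₀` to `A`
(`GNS.mem_weakCommutant_of_incl`). As `ω` is primary, `T = c • 1`. With `t_j = τ_{g_j}(x)`, the
numbers `ω(a t_j) = ⟪λ_ω(a*), π(t_j) ξ_ω⟫` and `ω(t_j)` therefore converge along the ultrafilter to
`c ω(a)` and `c`, which is the cluster property. The statement about the means follows by taking
Cesàro averages.
-/

/-! ### Weak limits of bounded families of operators -/

/-- Weak operator compactness of balls: a bounded family of operators converges in the weak operator
topology along every ultrafilter. -/
lemma exists_weak_operator_limit {ι H : Type*} [NormedAddCommGroup H] [InnerProductSpace ℂ H]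
    [CompleteSpace H] (U : Ultrafilter ι) (P : ι → H →L[ℂ] H) (M : ℝ) (hM : ∀ i, ‖P i‖ ≤ M) :
    ∃ T : H →L[ℂ] H, ∀ u v : H,
      Tendsto (fun i => inner ℂ u (P i v)) U (𝓝 (inner ℂ u (T v))) := by
  have hlim : ∀ u v : H, ∃ z ∈ Metric.closedBall (0 : ℂ) (M * ‖u‖ * ‖v‖),
      Tendsto (fun i => inner ℂ u (P i v)) U (𝓝 z) := by
    intro u v
    refine (isCompact_closedBall (0 : ℂ) (M * ‖u‖ * ‖v‖)).ultrafilter_le_nhds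
      (U.map fun i => inner ℂ u (P i v)) ?_
    refine tendsto_principal.2 (Eventually.of_forall fun i => mem_closedBall_zero_iff.2 ?_)
    calc ‖inner ℂ u (P i v)‖ ≤ ‖u‖ * (‖P i‖ * ‖v‖) :=
          (norm_inner_le_norm u _).trans (by gcongr; exact (P i).le_opNorm v)
      _ ≤ ‖u‖ * (M * ‖v‖) := by gcongr; exact hM i
      _ = M * ‖u‖ * ‖v‖ := by ring
  choose z hz hzlim using hlim
  let B₀ : H →ₗ⋆[ℂ] H →ₗ[ℂ] ℂ := LinearMap.mk₂'ₛₗ (starRingEnd ℂ) (RingHom.id ℂ) z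
    (fun u u' v => tendsto_nhds_unique (hzlim _ _) <| by
      simpa only [inner_add_left] using (hzlim u v).add (hzlim u' v))
    (fun c u v => tendsto_nhds_unique (hzlim _ _) <| by
      simpa only [inner_smul_left, smul_eq_mul] using (hzlim u v).const_mul (starRingEnd ℂ c))
    (fun u v v' => tendsto_nhds_unique (hzlim _ _) <| by
      simpa only [map_add, inner_add_right] using (hzlim u v).add (hzlim u v'))
    (fun c u v => tendsto_nhds_unique (hzlim _ _) <| by
      simpa only [map_smul, inner_smul_right, RingHom.id_apply, smul_eq_mul]
        using (hzlim u v).const_mul c)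
  let B : H →L⋆[ℂ] H →L[ℂ] ℂ :=
    B₀.mkContinuous₂ M fun u v => mem_closedBall_zero_iff.1 (hz u v)
  refine ⟨ContinuousLinearMap.adjoint (InnerProductSpace.continuousLinearMapOfBilin B),
    fun u v => ?_⟩
  rw [ContinuousLinearMap.adjoint_inner_right,
    InnerProductSpace.continuousLinearMapOfBilin_apply]
  exact hzlim u v

/-! ### The GNS representation of `A₀` by bounded operators -/

namespace GNS

open QuasiStarAlgebra

variable {A₀ A : Type u} [Ring A₀] [StarRing A₀] [Algebra ℂ A₀] [StarModule ℂ A₀]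
  [AddCommGroup A] [Module ℂ A] [StarAddMonoid A] [StarModule ℂ A] [QuasiStarAlgebra A₀ A]
  {ω : A →ₗ[ℂ] ℂ} (hω : IsRepresentable A₀ ω)

/-- Left multiplication by the image in `A₀` of an element `c` of a C*-algebra is bounded for the GNS
seminorm: `ω` is nonnegative on `b* (‖c‖² - c* c) b`, because `‖c‖² - c* c = d* d`. -/
lemma norm_vec₀_mul_le {C : Type*} [CStarAlgebra C] (φ : C →⋆ₐ[ℂ] A₀) (c : C) (b : A₀) :
    ‖vec₀ hω (φ c * b)‖ ≤ ‖c‖ * ‖vec₀ hω b‖ := by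
  let _ : PartialOrder C := CStarAlgebra.spectralOrder C
  let _ : StarOrderedRing C := CStarAlgebra.spectralOrderedRing C
  obtain ⟨d, hd⟩ := CStarAlgebra.nonneg_iff_eq_star_mul_self.1
    (sub_nonneg.2 (CStarAlgebra.star_mul_le_algebraMap_norm_sq (a := c)))
  have hφ : star (φ d * b) * (φ d * b) =
      ((‖c‖ ^ 2 : ℝ) : ℂ) • (star b * b) - star (φ c * b) * (φ c * b) := by
    have h : star (φ d) * φ d = ((‖c‖ ^ 2 : ℝ) : ℂ) • (1 : A₀) - star (φ c) * φ c := by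
      have h' := congrArg φ hd
      rw [IsScalarTower.algebraMap_apply ℝ ℂ C, Algebra.algebraMap_eq_smul_one] at h'
      simpa only [map_sub, map_mul, map_star, map_smul, map_one, Complex.coe_algebraMap]
        using h'.symm
    calc star (φ d * b) * (φ d * b) = star b * (star (φ d) * φ d) * b := by
          simp only [star_mul, mul_assoc]
      _ = _ := by
          rw [h]
          simp only [mul_sub, sub_mul, mul_smul_comm, smul_mul_assoc, mul_one, star_mul, mul_assoc]
  have hpos := (Complex.nonneg_iff.1 (hω.nonneg (φ d * b))).1
  rw [hφ, map_sub, map_smul, map_sub, map_smul, Complex.sub_re, smul_eq_mul,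
    Complex.re_ofReal_mul, sub_nonneg] at hpos
  rw [norm_vec₀, norm_vec₀]
  calc √(ω (incl (star (φ c * b) * (φ c * b)))).re
      ≤ √(‖c‖ ^ 2 * (ω (incl (star b * b))).re) := Real.sqrt_le_sqrt hpos
    _ = ‖c‖ * √(ω (incl (star b * b))).re := by
      rw [Real.sqrt_mul (sq_nonneg _), Real.sqrt_sq (norm_nonneg _)]

/-- An element of `A₀` whose left multiplication is bounded for the GNS seminorm acts on the whole
GNS space. -/
lemma exists_bounded_extension (x : A₀) (M : ℝ) (hM : 0 ≤ M)
    (hx : ∀ b : A₀, ‖vec₀ hω (x * b)‖ ≤ M * ‖vec₀ hω b‖) :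
    ∃ P : GNSSpace hω →L[ℂ] GNSSpace hω, ‖P‖ ≤ M ∧ ∀ b : A₀, P (vec₀ hω b) = vec₀ hω (x * b) := by
  have hnorm : ∀ a : PreGNS hω, ‖vec₀ hω ((PreGNS.mk hω).symm a)‖ = ‖a‖ := fun a =>
    UniformSpace.Completion.norm_coe a
  let f : PreGNS hω →L[ℂ] GNSSpace hω :=
    LinearMap.mkContinuous (vec₀ hω ∘ₗ LinearMap.mulLeft ℂ x ∘ₗ (PreGNS.mk hω).symm.toLinearMap) M
      (fun a => (hx ((PreGNS.mk hω).symm a)).trans_eq (by rw [hnorm]))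
  let P : GNSSpace hω →L[ℂ] GNSSpace hω := f.extend UniformSpace.Completion.toComplL
  have hP : ∀ b : A₀, P (vec₀ hω b) = vec₀ hω (x * b) := fun b =>
    ContinuousLinearMap.extend_eq f UniformSpace.Completion.denseRange_coe
      (UniformSpace.Completion.isUniformInducing_coe _) (PreGNS.mk hω b)
  refine ⟨P, P.opNorm_le_bound hM fun v => ?_, hP⟩
  refine (denseRange_vec₀ hω).induction_on (p := fun v => ‖P v‖ ≤ M * ‖v‖) v
    (isClosed_le (by fun_prop) (by fun_prop)) fun b => ?_
  rw [hP]
  exact hx b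

/-! ### The weak commutant of the GNS representation -/

/-- An operator satisfying the defining identity of the weak commutant for the elements of `A₀`
belongs to the weak commutant of the whole of `π_ω(A)`: for fixed vectors, both sides of the identity
are `τ_rep`-continuous in the element of `A`. -/
lemma mem_weakCommutant_of_incl
    (hdense : @Dense A (tauRep A₀ A) (Set.range (incl : A₀ →ₗ[ℂ] A)))
    (T : GNSSpace hω →L[ℂ] GNSSpace hω)
    (hT : ∀ y b c : A₀, inner ℂ (vec₀ hω c) (T (vec₀ hω (y * b))) =
      inner ℂ (vec₀ hω (star y * c)) (T (vec₀ hω b))) :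
    T ∈ weakCommutant (Set.range (rep hω).toLin) := by
  rintro _ ⟨a, rfl⟩ ξ η
  let _ : TopologicalSpace A := tauRep A₀ A
  have hcont : ∀ ζ : dom hω,
      Continuous fun a : A => (((rep hω).toLin a).1 ζ, dag ((rep hω).toLin a) ζ) := by
    intro ζ
    refine continuous_iff_le_induced.2 ?_
    exact iInf_le_of_le (GNSSpace hω) <| iInf_le_of_le _ <| iInf_le_of_le _ <|
      iInf_le_of_le _ <| iInf_le_of_le (dom hω) <| iInf_le_of_le (rep hω) <| iInf_le _ ζ
  have hclosed : IsClosed {a : A |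
      inner ℂ (ContinuousLinearMap.adjoint T (η : GNSSpace hω)) (((rep hω).toLin a).1 ξ) =
        inner ℂ (dag ((rep hω).toLin a) η) (T (ξ : GNSSpace hω))} :=
    isClosed_eq (continuous_const.inner (hcont ξ).fst) ((hcont η).snd.inner continuous_const)
  refine hdense.induction (P := fun a =>
      inner ℂ (ContinuousLinearMap.adjoint T (η : GNSSpace hω)) (((rep hω).toLin a).1 ξ) =
        inner ℂ (dag ((rep hω).toLin a) η) (T (ξ : GNSSpace hω))) ?_ hclosed a
  rintro _ ⟨y, rfl⟩
  obtain ⟨b, rfl⟩ := domVec_surjective hω ξ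
  obtain ⟨c, rfl⟩ := domVec_surjective hω η
  change inner ℂ (ContinuousLinearMap.adjoint T (vec₀ hω c)) (op hω (incl y) (domVec hω b)) =
    inner ℂ (dag (opLin hω (incl y)) (domVec hω c)) (T (vec₀ hω b))
  rw [dag_opLin, star_incl, op_domVec, op_domVec, rmul_incl, rmul_incl, vec_incl, vec_incl,
    ContinuousLinearMap.adjoint_inner_left]
  exact hT y b c

lemma inner_of_mem_weakCommutant {X : GNSSpace hω →L[ℂ] GNSSpace hω}
    (hX : X ∈ weakCommutant (Set.range (rep hω).toLin)) (y b c : A₀) :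
    inner ℂ (vec₀ hω c) (X (vec₀ hω (y * b))) = inner ℂ (vec₀ hω (star y * c)) (X (vec₀ hω b)) := by
  have h := hX _ ⟨incl y, rfl⟩ (domVec hω b) (domVec hω c)
  change inner ℂ (ContinuousLinearMap.adjoint X (vec₀ hω c)) (op hω (incl y) (domVec hω b)) =
    inner ℂ (dag (opLin hω (incl y)) (domVec hω c)) (X (vec₀ hω b)) at h
  rwa [dag_opLin, star_incl, op_domVec, op_domVec, rmul_incl, rmul_incl, vec_incl, vec_incl,
    ContinuousLinearMap.adjoint_inner_left] at h

lemma commute_of_mem_weakCommutant {X P : GNSSpace hω →L[ℂ] GNSSpace hω}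
    (hX : X ∈ weakCommutant (Set.range (rep hω).toLin)) (y : A₀)
    (hP : ∀ b : A₀, P (vec₀ hω b) = vec₀ hω (y * b)) : Commute X P := by
  have hadj : ∀ c : A₀, ContinuousLinearMap.adjoint P (vec₀ hω c) = vec₀ hω (star y * c) := by
    refine fun c => ext_inner hω fun b => ?_
    rw [ContinuousLinearMap.adjoint_inner_left, hP, inner_vec₀, inner_vec₀, star_mul, star_star,
      mul_assoc]
  have hpt : ∀ b : A₀, X (P (vec₀ hω b)) = P (X (vec₀ hω b)) := by
    intro b
    refine Dense.eq_of_inner_right ℂ (denseRange_vec₀ hω) ?_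
    rintro _ ⟨c, rfl⟩
    rw [hP, inner_of_mem_weakCommutant hω hX, ← hadj, ContinuousLinearMap.adjoint_inner_left]
  exact ContinuousLinearMap.ext fun v => congrFun
    ((denseRange_vec₀ hω).equalizer (X * P).continuous (P * X).continuous (funext hpt)) v

/-! ### Asymptotically central sequences in a primary representation -/

/-- For a primary state, a sequence of `A₀` which is asymptotically central and uniformly bounded in
the GNS representation has the cluster property. -/
lemma tendsto_of_asymptotically_central (hone : ω (incl (1 : A₀)) = 1) (hprimary : IsPrimary hω)
    (hdense : @Dense A (tauRep A₀ A) (Set.range (incl : A₀ →ₗ[ℂ] A)))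
    (t : ℕ → A₀) (M : ℝ) (hM : 0 ≤ M)
    (hbound : ∀ j b, ‖vec₀ hω (t j * b)‖ ≤ M * ‖vec₀ hω b‖)
    (hcomm : ∀ y : A₀, ∀ᶠ j in atTop, t j * y = y * t j) (a : A) :
    Tendsto (fun j => ω (rmul a (t j)) - ω a * ω (incl (t j))) atTop (𝓝 0) := by
  choose P hPM hP using fun j => exists_bounded_extension hω (t j) M hM (hbound j)
  refine (tendsto_iff_ultrafilter _ _ _).2 fun U hU => ?_
  obtain ⟨T, hT⟩ := exists_weak_operator_limit U P M hPM
  -- Asymptotic centrality puts the limit into the weak commutant.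
  have hTmem : T ∈ weakCommutant (Set.range (rep hω).toLin) := by
    refine mem_weakCommutant_of_incl hω hdense T fun y b c => ?_
    refine tendsto_nhds_unique_of_eventuallyEq (hT _ _) (hT _ _) ?_
    filter_upwards [hU (hcomm y)] with j hj
    rw [hP, hP, inner_vec₀, inner_vec₀, star_mul, star_star, mul_assoc (star c), ← mul_assoc y,
      ← mul_assoc (t j), show t j * y = y * t j from hj]
  -- Each `P j` commutes with the weak commutant, hence so does the weak limit.
  have hTcent : T ∈ Set.centralizer (weakCommutant (Set.range (rep hω).toLin)) := by
    intro X hX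
    refine ContinuousLinearMap.ext fun v => ext_inner_left ℂ fun u => ?_
    change inner ℂ u (X (T v)) = inner ℂ u (T (X v))
    rw [← ContinuousLinearMap.adjoint_inner_left]
    refine tendsto_nhds_unique_of_eventuallyEq (hT _ _) (hT _ _) (Eventually.of_forall fun j => ?_)
    have h : X (P j v) = P j (X v) :=
      DFunLike.congr_fun (commute_of_mem_weakCommutant hω hX (t j) (hP j)).eq v
    simp only [ContinuousLinearMap.adjoint_inner_left, h]
  obtain ⟨k, rfl⟩ := hprimary T ⟨hTmem, hTcent⟩
  have hωlim : ∀ a : A, Tendsto (fun j => ω (rmul a (t j))) U (𝓝 (k * ω a)) := by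
    intro a
    have h := hT (vec hω (star a)) (vec₀ hω 1)
    simpa only [hP, inner_vec, star_star, mul_one, rmul_one, FunLike.coe_smul, Pi.smul_apply,
      one_apply_eq_self, inner_smul_right] using h
  have h1 := hωlim (incl (1 : A₀))
  simp only [rmul_incl, one_mul, hone, mul_one] at h1
  have h := (hωlim a).sub (h1.const_mul (ω a))
  rwa [mul_comm k, sub_self] at h

end GNS

/-! ### The local structure and the means -/

section Cluster

open QuasiStarAlgebra

variable {A₀ A : Type u} [Ring A₀] [StarRing A₀] [Algebra ℂ A₀] [StarModule ℂ A₀]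
  [AddCommGroup A] [Module ℂ A] [StarAddMonoid A] [StarModule ℂ A] [QuasiStarAlgebra A₀ A]

/-- Asymptotic abelianness: translates of `x` commute eventually with any given `y`, because `x` and
`y` lie in a common local algebra `A_α` and `g_j α ⊥ α` eventually. -/
lemma CovariantAction.eventually_commute {F : Type v} [Preorder F] [IsDirectedOrder F]
    {perp : F → F → Prop} {L : LocalNet A₀ perp} {G : Type*} [Group G] [MulAction G F]
    (S : CovariantAction L G) (g : ℕ → G)
    (hg : ∀ α : F, ∃ j₀ : ℕ, ∀ j ≥ j₀, perp (g j • α) α) (x y : A₀) :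
    ∀ᶠ j in atTop, S.τ (g j) x * y = y * S.τ (g j) x := by
  obtain ⟨α, hα⟩ := L.exhaust x
  obtain ⟨β, hβ⟩ := L.exhaust y
  obtain ⟨γ, hαγ, hβγ⟩ := exists_ge_ge α β
  obtain ⟨j₀, hj₀⟩ := hg γ
  filter_upwards [eventually_ge_atTop j₀] with j hj
  refine L.commute _ _ (hj₀ j hj) _ ?_ y (L.mono γ β hβγ hβ)
  rw [← S.covariant]
  exact ⟨x, L.mono γ α hαγ hα, rfl⟩

/-- The translates of an element of `A₀` are uniformly bounded in the GNS representation. -/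
lemma CovariantAction.exists_bound {F : Type v} [Preorder F]
    {perp : F → F → Prop} {L : LocalNet A₀ perp} {G : Type*} [Group G] [MulAction G F]
    (S : CovariantAction L G) {ω : A →ₗ[ℂ] ℂ} (hω : IsRepresentable A₀ ω) (x : A₀) :
    ∃ M : ℝ, 0 ≤ M ∧
      ∀ (g : G) (b : A₀), ‖GNS.vec₀ hω (S.τ g x * b)‖ ≤ M * ‖GNS.vec₀ hω b‖ := by
  obtain ⟨α, c, rfl⟩ := L.exhaust x
  refine ⟨‖c‖, norm_nonneg c, fun g b => ?_⟩
  obtain ⟨d, hd⟩ : S.τ g (L.emb α c) ∈ Set.range (L.emb (g • α)) :=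
    S.covariant g α ▸ ⟨_, ⟨c, rfl⟩, rfl⟩
  rw [← hd, ← S.isometric g α (g • α) c d hd.symm]
  exact GNS.norm_vec₀_mul_le hω (L.emb (g • α)) d b

/-- The cluster property passes to the means, by Cesàro's theorem. -/
lemma HasClusterProperty.tendsto_meanTo {σ : ℕ → A₀ ≃⋆ₐ[ℂ] A₀} {ω : A →ₗ[ℂ] ℂ}
    (h : HasClusterProperty σ ω) (a : A) (x : A₀) :
    Tendsto (fun N => ω (rmul a (meanTo σ x N)) - ω a * ω (incl (meanTo σ x N))) atTop (𝓝 0) := by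
  have hc := (((tendsto_zero_iff_norm_tendsto_zero.2 (h a x)).comp
    (tendsto_add_atTop_nat 1)).cesaro_smul)
  refine hc.congr fun N => ?_
  simp only [Function.comp_def, meanTo, map_smul, map_sum, smul_eq_mul]
  rw [Finset.range_eq_Ico,
    Finset.sum_Ico_add' (fun j => ω (rmul a (σ j x)) - ω a * ω (incl (σ j x))) 0 N 1, zero_add,
    show Finset.Ico 1 (N + 1) = Finset.Icc 1 N from rfl, Finset.sum_sub_distrib,
    ← Finset.mul_sum, Complex.real_smul, Complex.ofReal_inv, Complex.ofReal_natCast]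
  ring

end Cluster

theorem mainTheorem2 {A₀ A : Type u} [Ring A₀] [StarRing A₀] [Algebra ℂ A₀] [StarModule ℂ A₀]
    [AddCommGroup A] [Module ℂ A] [StarAddMonoid A] [StarModule ℂ A] [QuasiStarAlgebra A₀ A]
    (hfaithful : RepFaithful A₀ A)
    (hdense : @Dense A (tauRep A₀ A) (Set.range (QuasiStarAlgebra.incl : A₀ →ₗ[ℂ] A)))
    {F : Type v} [Preorder F] [IsDirectedOrder F] (perp : F → F → Prop)
    (hperp : IsOrthogonality perp) (L : LocalNet A₀ perp)
    {G : Type*} [Group G] [MulAction G F] (S : CovariantAction L G)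
    (g : ℕ → G) (hg : ∀ α : F, ∃ j₀ : ℕ, ∀ j ≥ j₀, perp (g j • α) α)
    (ω : A →ₗ[ℂ] ℂ) (hω : IsState A₀ ω) (hprimary : IsPrimary hω.1) :
    HasClusterProperty (fun j => S.τ (g j)) ω ∧
      ∀ x : A₀, ω ∈ domInfty A (fun j => S.τ (g j)) x → ∀ a : A,
        Tendsto
          (fun N => ‖ω (QuasiStarAlgebra.rmul a (meanTo (fun j => S.τ (g j)) x N)) -
            ω a * valueInfty (fun j => S.τ (g j)) x ω‖)
          atTop (𝓝 0) := by
  have hcluster : HasClusterProperty (fun j => S.τ (g j)) ω := by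
    intro a x
    obtain ⟨M, hM, hbound⟩ := S.exists_bound hω.1 x
    exact tendsto_zero_iff_norm_tendsto_zero.1 <|
      GNS.tendsto_of_asymptotically_central hω.1 hω.2 hprimary hdense _ M hM
        (fun j => hbound (g j)) (S.eventually_commute g hg x) a
  refine ⟨hcluster, fun x hx a => ?_⟩
  obtain ⟨-, l, hl⟩ := hx
  rw [show valueInfty (fun j => S.τ (g j)) x ω = l from hl.limUnder_eq]
  refine tendsto_zero_iff_norm_tendsto_zero.1 ?_
  have h := (HasClusterProperty.tendsto_meanTo hcluster a x).add
    ((hl.sub_const l).const_mul (ω a))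
  rw [sub_self, mul_zero, add_zero] at h
  exact h.congr fun N => by ring
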